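/- Let $(\lambda_i)_{i\ge 0}$ be positive reals with $\sup_i\lambda_i<\infty$ and $\liminf_{i\to\infty}\lambda_i=0$, and let $(p_i)_{i\ge1}$ be positive reals with $\sum_{i\ge1}p_i=1$ and $\sum_{i\ge1}p_i\lambda_i^{-1}<\infty$. Let $X=(X_t)_{t\ge0}$ be the jump process on $\mathbb Z_+$ which stays in a state $i$ for an exponentially distributed time with expectation $\lambda_i^{-1}$, independent of the past, and then jumps to $j$ with probability $Q(i,j)$, where $Q(0,i)=p_i$ and $Q(i,0)=1$ for all $i\ge1$ (all other entries of $Q$ being $0$). Let $P^t(x,\cdot)$ denote the law of $X_t$ when $X_0=x$. Then $X$ is not geometrically ergodic: there are no invariant probability measure $\pi$ and no $\kappa>1$ such that $$\lim_{t\to\infty}\kappa^t\,\|P^t(x,\cdot)-\pi\|_{\mathrm{TV}}=0\quad\text{for all }x\in\mathbb Z_+,\qquad \|\mu\|_{\mathrm{TV}}:=\sup_A\mu(A)-\inf_A\mu(A).$$ Moreover, if $\pi$ is an invariant probability measure of $X$, then for every $m>0$ the conductance of the skeleton chain $P^m$ is zero: $$\inf_{A:\,0<\pi(A)<1}\ \frac{1}{\pi(A)\,\pi(A^c)}\int_A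 P^m(x,A^c)\,\pi(dx)=0.$$ -/

import Mathlib

open MeasureTheory ProbabilityTheory Filter Topology
open scoped NNReal ENNReal

namespace ToyJump

noncomputable section

/-- The jump matrix of the toy process: from `0` the process jumps to `j` with probability `p j`;
from any `i ≥ 1` it jumps to `0` with probability `1`. -/
def jumpMatrix (p : ℕ → ℝ) (i j : ℕ) : ℝ :=
  if i = 0 then p j else if j = 0 then 1 else 0

/-- Under the probability measure `μ`, the `ℕ`-valued process `X` is a jump process started at `x`:
it visits successively the states `Y 0, Y 1, …` and stays in `Y n` for the duration `H n`, where
`Y` is a Markov chain with transition matrix `Q` started at `x` and, given `Y`, the holding times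
`H n` are independent and exponentially distributed with parameter `lam (Y n)`
(that is, with expectation `(lam (Y n))⁻¹`).
The path is prescribed up to the explosion time `∑ n, H n`, which is almost surely infinite
when `lam` is bounded. -/
structure IsJumpProcess (lam : ℕ → ℝ) (Q : ℕ → ℕ → ℝ) (x : ℕ)
    {Ω : Type*} [MeasurableSpace Ω] (μ : Measure Ω) (X : ℝ≥0 → Ω → ℕ) : Prop where
  isProbabilityMeasure : IsProbabilityMeasure μ
  measurable : ∀ t, Measurable (X t)
  exists_jumpChain_holdingTimes : ∃ (Y : ℕ → Ω → ℕ) (H : ℕ → Ω → ℝ),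
    (∀ n, Measurable (Y n)) ∧ (∀ n, Measurable (H n)) ∧
    (∀ (n : ℕ) (y : ℕ → ℕ) (B : ℕ → Set ℝ), (∀ k, MeasurableSet (B k)) →
      μ {ω | ∀ k ≤ n, Y k ω = y k ∧ H k ω ∈ B k} =
        (if y 0 = x then 1 else 0)
          * (∏ k ∈ Finset.range n, ENNReal.ofReal (Q (y k) (y (k + 1))))
          * ∏ k ∈ Finset.range (n + 1), expMeasure (lam (y k)) (B k)) ∧
    ∀ᵐ ω ∂μ, ∀ (n : ℕ) (t : ℝ≥0),
      ∑ k ∈ Finset.range n, H k ω ≤ t → (t : ℝ) < ∑ k ∈ Finset.range (n + 1), H k ω →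
        X t ω = Y n ω

/-- The transition kernels `P^t(x, ·)`: the law of `X t` under the law `P x` of the process started
at `x`. -/
def transition {Ω : Type*} [MeasurableSpace Ω] (P : ℕ → Measure Ω) (X : ℝ≥0 → Ω → ℕ) (t : ℝ≥0) :
    Kernel ℕ ℕ :=
  Kernel.ofFunOfCountable fun x => (P x).map (X t)

/-- The total variation norm `sup_A (μ - ν)(A) - inf_A (μ - ν)(A)` of the difference of two finite
measures. -/
def tvNorm {α : Type*} [MeasurableSpace α] (μ ν : Measure α) : ℝ :=
  (⨆ A : {A : Set α // MeasurableSet A}, (μ.real A - ν.real A)) -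
    ⨅ A : {A : Set α // MeasurableSet A}, (μ.real A - ν.real A)

/-- `π` is an invariant probability measure of the family of kernels `(K t)`. -/
def IsInvariantDistribution {α : Type*} [MeasurableSpace α] (K : ℝ≥0 → Kernel α α)
    (π : Measure α) : Prop :=
  IsProbabilityMeasure π ∧ ∀ t, (K t).Invariant π

/-- Geometric ergodicity: for some invariant probability measure `π` and some `κ > 1`,
`κ ^ t * ‖P^t(x, ·) - π‖_TV → 0` as `t → ∞`, for every initial state `x`. -/
def IsGeometricallyErgodic {α : Type*} [MeasurableSpace α] (K : ℝ≥0 → Kernel α α) : Prop :=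
  ∃ π : Measure α, IsInvariantDistribution K π ∧
    ∃ κ : ℝ, 1 < κ ∧ ∀ x : α,
      Tendsto (fun t : ℝ≥0 => κ ^ (t : ℝ) * tvNorm (K t x) π) atTop (𝓝 0)

/-- The conductance of a kernel `K` with respect to `π`: the infimum, over the measurable sets `A`
with `π A` and `π Aᶜ` nonzero, of `(π A * π Aᶜ)⁻¹ * ∫_A K(x, Aᶜ) π(dx)`. -/
def conductance {α : Type*} [MeasurableSpace α] (π : Measure α) (K : Kernel α α) : ℝ≥0∞ :=
  ⨅ (A : Set α) (_ : MeasurableSet A) (_ : π A ≠ 0) (_ : π Aᶜ ≠ 0),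
    (π A * π Aᶜ)⁻¹ * ∫⁻ x in A, K x Aᶜ ∂π

end

end ToyJump

/-! A state `i` with small `lam i` is a trap, left before time `t` with probability at most `1 - exp
(-lam i * t)`, and there are traps with `lam i` arbitrarily small. For the conductance, take `A =
{i}`: the escape probability is at most `lam i * m`, and `π Aᶜ ≥ 1/2` for large `i`, so the quotient
is at most `2 * lam i * m`.

Suppose the process were ergodic at rate `κ = exp b`, and let `a = π {0} > 0`. Started at `0`, it is
in `0` at time `s` with probability at most `a + c * exp (-b s)`. From `i ≥ 1` the first jump leads
to `0`, so conditioning on its time (`IsJumpProcess.measure_le_setLIntegral`) and integrating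
(`setLIntegral_expMeasure_le`) gives, for `λ = lam i < b`, `P^t(i, {0}) ≤ a - (a - c λ / (b - λ)) *
exp (-λ t)`. For small `λ` the bracket is at least `a / 2`, so the distance to `π` decays no faster
than `exp (-λ t)`, too slow for the rate `b`. -/

namespace ToyJump

/-! ### Exponential laws and the integral over the first holding time. -/

section Exponential

variable {r t : ℝ}

lemma expMeasure_Iic (hr : 0 < r) (ht : 0 ≤ t) :
    expMeasure r (Set.Iic t) = ENNReal.ofReal (1 - Real.exp (-(r * t))) := by
  have := isProbabilityMeasure_expMeasure hr
  rw [← ofReal_cdf, cdf_expMeasure_eq hr, if_pos ht]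

lemma expMeasure_Ioi (hr : 0 < r) (ht : 0 ≤ t) :
    expMeasure r (Set.Ioi t) = ENNReal.ofReal (Real.exp (-(r * t))) := by
  have := isProbabilityMeasure_expMeasure hr
  rw [← Set.compl_Iic, prob_compl_eq_one_sub measurableSet_Iic, expMeasure_Iic hr ht,
    ← ENNReal.ofReal_one, ← ENNReal.ofReal_sub _ (by
      have : Real.exp (-(r * t)) ≤ 1 := Real.exp_le_one_iff.2 (by nlinarith)
      linarith)]
  congr 1; ring

lemma expMeasure_Iic_zero (hr : 0 < r) : expMeasure r (Set.Iic 0) = 0 := by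
  simp [expMeasure_Iic hr le_rfl]

lemma expMeasure_Iio_zero (hr : 0 < r) : expMeasure r (Set.Iio 0) = 0 :=
  measure_mono_null Set.Iio_subset_Iic_self (expMeasure_Iic_zero hr)

lemma expMeasure_Ioo_ne_zero (hr : 0 < r) (ht : 0 < t) : expMeasure r (Set.Ioo 0 t) ≠ 0 := by
  intro h
  have h1 : expMeasure r (Set.Iic (t / 2)) = 0 := by
    refine measure_mono_null (t := Set.Iic 0 ∪ Set.Ioo 0 t) (fun x hx => ?_)
      (measure_union_null (expMeasure_Iic_zero hr) h)
    rcases le_or_gt x 0 with h0 | h0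
    · exact Or.inl h0
    · exact Or.inr ⟨h0, by have : x ≤ t / 2 := hx; linarith⟩
  rw [expMeasure_Iic hr (by positivity), ENNReal.ofReal_eq_zero] at h1
  have : Real.exp (-(r * (t / 2))) < 1 := Real.exp_lt_one_iff.2 (by nlinarith)
  linarith

/-- The integral has an explicit primitive; the bound drops the negative term `-c * (r / (b - r)) *
exp (-(b * t))`. Since `r < b`, what remains decays at the slow rate `r`. -/
lemma setLIntegral_expMeasure_le (hr : 0 < r) (ht : 0 ≤ t) {a b c : ℝ} (ha : 0 ≤ a) (hc : 0 ≤ c)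
    (hb : r < b) :
    ∫⁻ h in Set.Icc 0 t, ENNReal.ofReal (a + c * Real.exp (-(b * (t - h)))) ∂expMeasure r ≤
      ENNReal.ofReal (a * (1 - Real.exp (-(r * t))) + c * (r / (b - r)) * Real.exp (-(r * t))) := by
  have hbr : 0 < b - r := sub_pos.2 hb
  set F : ℝ → ℝ := fun h =>
    -(a * Real.exp (-(r * h))) + c * (r / (b - r)) * (Real.exp (-(b * t)) * Real.exp ((b - r) * h))
  set f : ℝ → ℝ := fun h => (r * Real.exp (-(r * h))) * (a + c * Real.exp (-(b * (t - h))))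
  have hF : ∀ h, HasDerivAt F (f h) h := by
    intro h
    have h1 : HasDerivAt (fun h => Real.exp (-(r * h))) (Real.exp (-(r * h)) * (-(r * 1))) h :=
      (((hasDerivAt_id h).const_mul r).neg).exp
    have h2 : HasDerivAt (fun h => Real.exp ((b - r) * h))
        (Real.exp ((b - r) * h) * ((b - r) * 1)) h := ((hasDerivAt_id h).const_mul (b - r)).exp
    have h3 := ((h1.const_mul a).neg).add
      ((h2.const_mul (Real.exp (-(b * t)))).const_mul (c * (r / (b - r))))
    refine h3.congr_deriv ?_
    have e : Real.exp (-(r * h)) * Real.exp (-(b * (t - h))) =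
        Real.exp (-(b * t)) * Real.exp ((b - r) * h) := by
      rw [← Real.exp_add, ← Real.exp_add]; congr 1; ring
    have e' : f h = r * a * Real.exp (-(r * h)) +
        r * c * (Real.exp (-(r * h)) * Real.exp (-(b * (t - h)))) := by simp only [f]; ring
    rw [e', e]; field_simp
  have hfc : Continuous f := by fun_prop
  have hint : ∫ h in Set.Icc 0 t, f h = F t - F 0 := by
    rw [integral_Icc_eq_integral_Ioc, ← intervalIntegral.integral_of_le ht]
    exact intervalIntegral.integral_eq_sub_of_hasDerivAt (fun h _ => hF h)
      (hfc.intervalIntegrable _ _)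
  have hlint : ∫⁻ h in Set.Icc 0 t, ENNReal.ofReal (a + c * Real.exp (-(b * (t - h))))
      ∂expMeasure r = ∫⁻ h in Set.Icc 0 t, ENNReal.ofReal (f h) := by
    have hm : Measurable (exponentialPDF r) := (measurable_exponentialPDFReal r).ennreal_ofReal
    have : expMeasure r = volume.withDensity (exponentialPDF r) := rfl
    rw [this, setLIntegral_withDensity_eq_setLIntegral_mul _ hm (by fun_prop) measurableSet_Icc]
    refine setLIntegral_congr_fun measurableSet_Icc fun h hh => ?_
    simp only [Pi.mul_apply, f]
    rw [exponentialPDF_of_nonneg hh.1, ← ENNReal.ofReal_mul (by positivity)]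
  rw [hlint, ← ofReal_integral_eq_lintegral_ofReal
    (hfc.continuousOn.integrableOn_compact isCompact_Icc)
    (ae_of_all _ fun h => by simp only [Pi.zero_apply, f]; positivity), hint]
  refine ENNReal.ofReal_le_ofReal ?_
  have e : Real.exp (-(b * t)) * Real.exp ((b - r) * t) = Real.exp (-(r * t)) := by
    rw [← Real.exp_add]; congr 1; ring
  have h0 : 0 ≤ c * (r / (b - r)) * Real.exp (-(b * t)) := by positivity
  simp only [F, e, mul_zero, neg_zero, Real.exp_zero, mul_one]
  linarith

end Exponential

/-! ### Cylinders as a generating π-system on trajectory space. -/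

section Cylinder

/-- The sequences in `ℕ × ℝ` with prescribed first components and with second components in
prescribed sets, up to the index `n`. -/
def cylinder (n : ℕ) (y : ℕ → ℕ) (B : ℕ → Set ℝ) : Set (ℕ → ℕ × ℝ) :=
  {w | ∀ k ≤ n, (w k).1 = y k ∧ (w k).2 ∈ B k}

/-- The empty set and the cylinders with measurable sides. -/
def cylinders : Set (Set (ℕ → ℕ × ℝ)) :=
  {s | s = ∅ ∨ ∃ n y B, (∀ k, MeasurableSet (B k)) ∧ s = cylinder n y B}

lemma measurableSet_cylinder (n : ℕ) (y : ℕ → ℕ) {B : ℕ → Set ℝ} (hB : ∀ k, MeasurableSet (B k)) :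
    MeasurableSet (cylinder n y B) := by
  have : cylinder n y B = ⋂ k, ⋂ (_ : k ≤ n), (fun w : ℕ → ℕ × ℝ => w k) ⁻¹' ({y k} ×ˢ B k) := by
    ext w; simp [cylinder]
  rw [this]
  exact MeasurableSet.iInter fun k => MeasurableSet.iInter fun _ =>
    measurable_pi_apply k ((measurableSet_singleton _).prod (hB k))

lemma cylinder_inter_of_le {n m : ℕ} (hnm : n ≤ m) {y z : ℕ → ℕ} (hyz : ∀ k ≤ n, y k = z k)
    (B D : ℕ → Set ℝ) :
    cylinder n y B ∩ cylinder m z D = cylinder m z fun k => if k ≤ n then B k ∩ D k else D k := by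
  ext w
  simp only [cylinder, Set.mem_inter_iff, Set.mem_ofPred_eq]
  constructor
  · rintro ⟨h1, h2⟩ k hk
    refine ⟨(h2 k hk).1, ?_⟩
    split_ifs with h
    · exact ⟨(h1 k h).2, (h2 k hk).2⟩
    · exact (h2 k hk).2
  · intro h
    refine ⟨fun k hk => ?_, fun k hk => ?_⟩
    · have := h k (hk.trans hnm)
      rw [if_pos hk] at this
      exact ⟨this.1.trans (hyz k hk).symm, this.2.1⟩
    · have := h k hk
      refine ⟨this.1, ?_⟩
      have h' := this.2
      split_ifs at h' with h''
      exacts [h'.2, h']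

/-- Cylinders with conflicting states are disjoint, which is why `∅` is included. -/
lemma isPiSystem_cylinders : IsPiSystem cylinders := by
  have key : ∀ {n m : ℕ} (_ : n ≤ m) (y z : ℕ → ℕ) {B D : ℕ → Set ℝ},
      (∀ k, MeasurableSet (B k)) → (∀ k, MeasurableSet (D k)) →
      cylinder n y B ∩ cylinder m z D ∈ cylinders := by
    intro n m hnm y z B D hB hD
    by_cases hyz : ∀ k ≤ n, y k = z k
    · refine Or.inr ⟨m, z, _, fun k => ?_, cylinder_inter_of_le hnm hyz B D⟩
      split_ifs
      exacts [(hB k).inter (hD k), hD k]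
    · left
      push Not at hyz
      obtain ⟨k, hk, hne⟩ := hyz
      ext w
      simp only [Set.mem_inter_iff, Set.mem_empty_iff_false, iff_false]
      rintro ⟨h1, h2⟩
      exact hne ((h1 k hk).1.symm.trans (h2 k (hk.trans hnm)).1)
  rintro s (rfl | ⟨n, y, B, hB, rfl⟩) t (rfl | ⟨m, z, D, hD, rfl⟩) _
  · exact Or.inl (Set.empty_inter _)
  · exact Or.inl (Set.empty_inter _)
  · exact Or.inl (Set.inter_empty _)
  · rcases le_total n m with h | h
    · exact key h y z hB hD
    · rw [Set.inter_comm]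
      exact key h z y hD hB

lemma generateFrom_cylinders :
    (inferInstance : MeasurableSpace (ℕ → ℕ × ℝ)) = MeasurableSpace.generateFrom cylinders := by
  refine le_antisymm (iSup_le fun k => ?_) (MeasurableSpace.generateFrom_le ?_)
  · rintro _ ⟨E, hE, rfl⟩
    -- A cylinder fixes every state up to `k`, so the event is split over the countably many state
    -- paths `v`; the value `0` beyond `k` plays no role.
    have : (fun w : ℕ → ℕ × ℝ => w k) ⁻¹' E = ⋃ v : Fin (k + 1) → ℕ,
        cylinder k (fun j => if h : j < k + 1 then v ⟨j, h⟩ else 0)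
          fun j => if j = k then Prod.mk (v (Fin.last k)) ⁻¹' E else Set.univ := by
      ext w
      simp only [Set.mem_preimage, Set.mem_iUnion, cylinder, Set.mem_ofPred_eq]
      constructor
      · intro h
        refine ⟨fun j => (w j).1, fun j hj => ⟨by simp [Nat.lt_succ_of_le hj], ?_⟩⟩
        split_ifs with hjk
        · subst hjk; simpa using h
        · trivial
      · rintro ⟨v, hv⟩
        obtain ⟨h1, h2⟩ := hv k le_rfl
        simp only [Nat.lt_succ_self, dite_true] at h1
        rw [if_pos rfl, Set.mem_preimage] at h2
        have : v (Fin.last k) = (w k).1 := h1.symm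
        rwa [this] at h2
    rw [this]
    refine MeasurableSet.iUnion fun v => MeasurableSpace.measurableSet_generateFrom
      (Or.inr ⟨k, _, _, fun j => ?_, rfl⟩)
    split_ifs
    · exact measurable_prodMk_left hE
    · exact MeasurableSet.univ
  · rintro s (rfl | ⟨n, y, B, hB, rfl⟩)
    · exact MeasurableSet.empty
    · exact measurableSet_cylinder n y hB

end Cylinder

/-! ### Non-explosion and the Markov property at the first jump. -/

section JumpLaw

/-- The law of the jump chain `Y` and of the holding times `H` of a jump process started at `x`. -/
structure HasJumpLaw (lam : ℕ → ℝ) (Q : ℕ → ℕ → ℝ) (x : ℕ) {Ω : Type*} [MeasurableSpace Ω]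
    (μ : Measure Ω) (Y : ℕ → Ω → ℕ) (H : ℕ → Ω → ℝ) : Prop where
  measurable_chain : ∀ n, Measurable (Y n)
  measurable_holding : ∀ n, Measurable (H n)
  measure_eq : ∀ (n : ℕ) (y : ℕ → ℕ) (B : ℕ → Set ℝ), (∀ k, MeasurableSet (B k)) →
    μ {ω | ∀ k ≤ n, Y k ω = y k ∧ H k ω ∈ B k} =
      (if y 0 = x then 1 else 0)
        * (∏ k ∈ Finset.range n, ENNReal.ofReal (Q (y k) (y (k + 1))))
        * ∏ k ∈ Finset.range (n + 1), expMeasure (lam (y k)) (B k)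

/-- The joint trajectory of the jump chain and of the holding times. -/
def trajectory {Ω : Type*} (Y : ℕ → Ω → ℕ) (H : ℕ → Ω → ℝ) (ω : Ω) (k : ℕ) : ℕ × ℝ := (Y k ω, H k ω)

namespace HasJumpLaw

variable {lam : ℕ → ℝ} {Q : ℕ → ℕ → ℝ} {x : ℕ} {Ω : Type*} [MeasurableSpace Ω] {μ : Measure Ω}
  {Y : ℕ → Ω → ℕ} {H : ℕ → Ω → ℝ}

/-- Given the state path, the holding factor is at most `q`. Summing over paths costs nothing: the
path events `E v` are disjoint, so their masses add up to at most `1`. -/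
lemma measure_holding_le [IsProbabilityMeasure μ] (h : HasJumpLaw lam Q x μ Y H)
    (hlam : ∀ i, 0 < lam i) (n : ℕ) {B : ℕ → Set ℝ} (hB : ∀ k, MeasurableSet (B k)) {q : ℝ≥0∞}
    (hq : ∀ y : ℕ → ℕ, ∏ k ∈ Finset.range (n + 1), expMeasure (lam (y k)) (B k) ≤ q) :
    μ {ω | ∀ k ≤ n, H k ω ∈ B k} ≤ q := by
  set z : (Fin (n + 1) → ℕ) → ℕ → ℕ := fun v j => if h : j < n + 1 then v ⟨j, h⟩ else 0
  set E : (Fin (n + 1) → ℕ) → Set Ω := fun v => {ω | ∀ k ≤ n, Y k ω = z v k ∧ H k ω ∈ Set.univ}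
  have hprob : ∀ i, IsProbabilityMeasure (expMeasure (lam i)) := fun i =>
    isProbabilityMeasure_expMeasure (hlam i)
  have hE : ∀ v, MeasurableSet (E v) := fun v => by
    have : E v = ⋂ k, ⋂ (_ : k ≤ n), Y k ⁻¹' {z v k} := by ext ω; simp [E]
    rw [this]
    exact MeasurableSet.iInter fun k => MeasurableSet.iInter fun _ =>
      h.measurable_chain k (measurableSet_singleton _)
  have hdisj : Pairwise (Function.onFun Disjoint E) := by
    intro v v' hne
    refine Set.disjoint_left.2 fun ω hv hv' => hne (funext fun j => ?_)
    have h1 := (hv j (Nat.le_of_lt_succ j.2)).1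
    have h2 := (hv' j (Nat.le_of_lt_succ j.2)).1
    simpa [z, j.is_le] using h1.symm.trans h2
  have hsub : {ω | ∀ k ≤ n, H k ω ∈ B k} ⊆
      ⋃ v, {ω | ∀ k ≤ n, Y k ω = z v k ∧ H k ω ∈ B k} := fun ω hω => by
    refine Set.mem_iUnion.2 ⟨fun j => Y j ω, fun k hk => ⟨?_, hω k hk⟩⟩
    simp [z, hk]
  calc μ {ω | ∀ k ≤ n, H k ω ∈ B k}
      ≤ ∑' v, μ {ω | ∀ k ≤ n, Y k ω = z v k ∧ H k ω ∈ B k} :=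
        (measure_mono hsub).trans (measure_iUnion_le _)
    _ ≤ ∑' v, μ (E v) * q := by
        refine ENNReal.tsum_le_tsum fun v => ?_
        have hu : μ (E v) = _ := h.measure_eq n (z v) (fun _ => Set.univ) fun _ => MeasurableSet.univ
        rw [h.measure_eq n (z v) B hB, hu]
        simp only [measure_univ, Finset.prod_const_one, mul_one]
        gcongr
        exact hq _
    _ = μ (⋃ v, E v) * q := by rw [ENNReal.tsum_mul_right, measure_iUnion hdisj hE]
    _ ≤ 1 * q := by gcongr; exact prob_le_one
    _ = q := one_mul q

lemma ae_holding_nonneg [IsProbabilityMeasure μ] (h : HasJumpLaw lam Q x μ Y H)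
    (hlam : ∀ i, 0 < lam i) : ∀ᵐ ω ∂μ, ∀ n, 0 ≤ H n ω := by
  refine ae_all_iff.2 fun n => ?_
  have := h.measure_holding_le hlam n (B := fun k => if k = n then Set.Iio 0 else Set.univ) (q := 0)
    (fun k => by split_ifs; exacts [measurableSet_Iio, MeasurableSet.univ])
    (fun y => by
      rw [nonpos_iff_eq_zero, Finset.prod_eq_zero (Finset.self_mem_range_succ n)]
      simp [expMeasure_Iio_zero (hlam _)])
  refine measure_mono_null (fun ω hω => ?_) (nonpos_iff_eq_zero.1 this)
  intro k hk
  split_ifs with hkn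
  · subst hkn; simpa using hω
  · trivial

/-- Whatever the state, a holding time is at most `1` with probability at most `1 - exp (-M) < 1`;
long runs of such times have geometrically small probability. -/
lemma ae_frequently_one_lt [IsProbabilityMeasure μ] (h : HasJumpLaw lam Q x μ Y H)
    (hlam : ∀ i, 0 < lam i) {M : ℝ} (hM : ∀ i, lam i ≤ M) :
    ∀ᵐ ω ∂μ, ∀ n, ∃ k ≥ n, 1 < H k ω := by
  refine ae_all_iff.2 fun n => ?_
  set q : ℝ≥0∞ := ENNReal.ofReal (1 - Real.exp (-M))
  have hq : q < 1 := by
    rw [← ENNReal.ofReal_one]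
    exact (ENNReal.ofReal_lt_ofReal_iff one_pos).2 (by linarith [Real.exp_pos (-M)])
  have hprob : ∀ i, IsProbabilityMeasure (expMeasure (lam i)) := fun i =>
    isProbabilityMeasure_expMeasure (hlam i)
  have hle : ∀ m, μ {ω | ¬ ∃ k ≥ n, 1 < H k ω} ≤ q ^ m := by
    intro m
    refine le_trans (measure_mono ?_) (h.measure_holding_le hlam (n + m)
      (B := fun k => if n ≤ k then Set.Iic 1 else Set.univ)
      (fun k => by split_ifs; exacts [measurableSet_Iic, MeasurableSet.univ]) fun y => ?_)
    · intro ω hω k _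
      split_ifs with hnk
      · by_contra hlt
        exact hω ⟨k, hnk, not_le.1 hlt⟩
      · trivial
    · rw [show n + m + 1 = n + (m + 1) by ring, Finset.prod_range_add]
      calc _ ≤ 1 * ∏ _k ∈ Finset.range (m + 1), q := by
            gcongr with k _
            · exact Finset.prod_le_one' fun k _ => prob_le_one
            · rw [if_pos (Nat.le_add_right n k), expMeasure_Iic (hlam _) zero_le_one]
              refine ENNReal.ofReal_le_ofReal (sub_le_sub_left (Real.exp_le_exp.2 ?_) 1)
              linarith [hM (y (n + k))]
        _ ≤ q ^ m := by
            rw [one_mul, Finset.prod_const, Finset.card_range]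
            exact pow_le_pow_right_of_le_one' hq.le (Nat.le_succ m)
  exact nonpos_iff_eq_zero.1 (ge_of_tendsto' (ENNReal.tendsto_pow_atTop_nhds_zero_of_lt_one hq) hle)

/-- Non-explosion: infinitely many holding times exceed `1`, so their series diverges. -/
lemma ae_exists_sum_holding [IsProbabilityMeasure μ] (h : HasJumpLaw lam Q x μ Y H)
    (hlam : ∀ i, 0 < lam i) {M : ℝ} (hM : ∀ i, lam i ≤ M) :
    ∀ᵐ ω ∂μ, ∀ t : ℝ≥0, ∃ n, ∑ k ∈ Finset.range n, H k ω ≤ t ∧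
      (t : ℝ) < ∑ k ∈ Finset.range (n + 1), H k ω := by
  filter_upwards [h.ae_holding_nonneg hlam, h.ae_frequently_one_lt hlam hM] with ω h0 h1 t
  have hex : ∃ n, (t : ℝ) < ∑ k ∈ Finset.range n, H k ω := by
    by_contra hcon
    push Not at hcon
    have hs : Summable fun k => H k ω := summable_of_sum_range_le h0 hcon
    obtain ⟨n, hn⟩ := eventually_atTop.1 (hs.tendsto_atTop_zero.eventually_lt_const one_pos)
    obtain ⟨k, hk, hk1⟩ := h1 n
    exact (hn k hk).not_gt hk1
  classical
  obtain ⟨n, hn⟩ : ∃ n, Nat.find hex = n + 1 := Nat.exists_eq_succ_of_ne_zero fun h' => by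
    have := Nat.find_spec hex
    rw [h'] at this
    simp only [Finset.range_zero, Finset.sum_empty] at this
    exact absurd t.2 (not_le.2 this)
  refine ⟨n, not_lt.1 (Nat.find_min hex (by omega)), ?_⟩
  have := Nat.find_spec hex
  rwa [hn] at this

lemma measurable_trajectory (h : HasJumpLaw lam Q x μ Y H) : Measurable (trajectory Y H) :=
  measurable_pi_lambda _ fun k => (h.measurable_chain k).prodMk (h.measurable_holding k)

lemma map_trajectory_cylinder (h : HasJumpLaw lam Q x μ Y H) (n : ℕ) (y : ℕ → ℕ) {B : ℕ → Set ℝ}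
    (hB : ∀ k, MeasurableSet (B k)) :
    μ.map (trajectory Y H) (cylinder n y B) = (if y 0 = x then 1 else 0)
        * (∏ k ∈ Finset.range n, ENNReal.ofReal (Q (y k) (y (k + 1))))
        * ∏ k ∈ Finset.range (n + 1), expMeasure (lam (y k)) (B k) := by
  rw [Measure.map_apply h.measurable_trajectory (measurableSet_cylinder n y hB)]
  exact h.measure_eq n y B hB

end HasJumpLaw

/-- The sequence `w` preceded by `(i, h)`. -/
def consTrajectory (i : ℕ) (a : ℝ × (ℕ → ℕ × ℝ)) : ℕ → ℕ × ℝ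
  | 0 => (i, a.1)
  | k + 1 => a.2 k

lemma measurable_consTrajectory (i : ℕ) : Measurable (consTrajectory i) := by
  refine measurable_pi_lambda _ fun k => ?_
  cases k with
  | zero => exact measurable_const.prodMk measurable_fst
  | succ k => exact (measurable_pi_apply k).comp measurable_snd

lemma consTrajectory_preimage_cylinder_succ (i n : ℕ) (y : ℕ → ℕ) (B : ℕ → Set ℝ) :
    consTrajectory i ⁻¹' cylinder (n + 1) y B = if y 0 = i then
      B 0 ×ˢ cylinder n (fun k => y (k + 1)) (fun k => B (k + 1)) else ∅ := by
  ext a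
  simp only [cylinder, Set.mem_preimage, Set.mem_ofPred_eq]
  split_ifs with hy
  · constructor
    · intro h
      exact ⟨(h 0 (Nat.zero_le _)).2, fun k hk => h (k + 1) (by omega)⟩
    · rintro ⟨h1, h2⟩ (_ | k) hk
      · exact ⟨hy.symm, h1⟩
      · exact h2 k (by omega)
  · simp only [Set.mem_empty_iff_false, iff_false]
    exact fun h => hy (h 0 (Nat.zero_le _)).1.symm

lemma consTrajectory_preimage_cylinder_zero (i : ℕ) (y : ℕ → ℕ) (B : ℕ → Set ℝ) :
    consTrajectory i ⁻¹' cylinder 0 y B = if y 0 = i then B 0 ×ˢ Set.univ else ∅ := by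
  ext a
  simp only [cylinder, Set.mem_preimage, Set.mem_ofPred_eq]
  split_ifs with hy
  · constructor
    · intro h
      exact ⟨(h 0 le_rfl).2, trivial⟩
    · rintro ⟨h1, -⟩ k hk
      obtain rfl : k = 0 := by omega
      exact ⟨hy.symm, h1⟩
  · simp only [Set.mem_empty_iff_false, iff_false]
    exact fun h => hy (h 0 le_rfl).1.symm

/-- Started from a state which is followed by the state `j` with probability `1`, the trajectory
after the first jump is independent of the first holding time and has the law of a trajectory
started at `j`. -/
lemma HasJumpLaw.map_trajectory_eq_map_cons {lam : ℕ → ℝ} {Q : ℕ → ℕ → ℝ} {i j : ℕ}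
    {Ω Ω' : Type*} [MeasurableSpace Ω] [MeasurableSpace Ω'] {μ : Measure Ω} {μ' : Measure Ω'}
    [IsProbabilityMeasure μ] [IsProbabilityMeasure μ']
    {Y : ℕ → Ω → ℕ} {H : ℕ → Ω → ℝ} {Y' : ℕ → Ω' → ℕ} {H' : ℕ → Ω' → ℝ}
    (h : HasJumpLaw lam Q i μ Y H) (h' : HasJumpLaw lam Q j μ' Y' H') (hi : 0 < lam i)
    (hQ : ∀ k, Q i k = if k = j then 1 else 0) :
    μ.map (trajectory Y H) =
      ((expMeasure (lam i)).prod (μ'.map (trajectory Y' H'))).map (consTrajectory i) := by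
  have := isProbabilityMeasure_expMeasure hi
  have := Measure.isProbabilityMeasure_map (μ := μ) h.measurable_trajectory.aemeasurable
  have := Measure.isProbabilityMeasure_map (μ := μ') h'.measurable_trajectory.aemeasurable
  have := Measure.isProbabilityMeasure_map
    (μ := (expMeasure (lam i)).prod (μ'.map (trajectory Y' H')))
    (measurable_consTrajectory i).aemeasurable
  refine ext_of_generate_finite cylinders generateFrom_cylinders isPiSystem_cylinders ?_ (by simp)
  rintro s (rfl | ⟨n, y, B, hB, rfl⟩)
  · simp
  rw [h.map_trajectory_cylinder n y hB,
    Measure.map_apply (measurable_consTrajectory i) (measurableSet_cylinder n y hB)]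
  cases n with
  | zero =>
    rw [consTrajectory_preimage_cylinder_zero]
    split_ifs with hy
    · rw [Measure.prod_prod]; simp [hy]
    · simp
  | succ n =>
    rw [consTrajectory_preimage_cylinder_succ]
    split_ifs with hy
    -- The factor `Q i (y 1)` is the indicator of `y 1 = j`, which is the initial-state factor of
    -- the law started at `j`.
    · rw [Measure.prod_prod, h'.map_trajectory_cylinder n _ fun k => hB (k + 1),
        Finset.prod_range_succ' _ n, Finset.prod_range_succ' _ (n + 1), hy, zero_add, hQ]
      split_ifs <;> simp [mul_comm, mul_left_comm]
    · simp

end JumpLaw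

/-! ### Estimates for the process at a fixed time. -/

section Renewal

/-- The trajectories which are in the state `z` at time `t`. -/
def visits (z : ℕ) (t : ℝ) : Set (ℕ → ℕ × ℝ) :=
  {w | ∃ n, (w n).1 = z ∧ ∑ k ∈ Finset.range n, (w k).2 ≤ t ∧
    t < ∑ k ∈ Finset.range (n + 1), (w k).2}

lemma measurableSet_visits (z : ℕ) (t : ℝ) : MeasurableSet (visits z t) := by
  have : visits z t = ⋃ n, ((fun w : ℕ → ℕ × ℝ => (w n).1) ⁻¹' {z} ∩
      ({w | ∑ k ∈ Finset.range n, (w k).2 ≤ t} ∩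
        {w | t < ∑ k ∈ Finset.range (n + 1), (w k).2})) := by
    ext w; simp [visits]
  rw [this]
  have hs : ∀ n, Measurable fun w : ℕ → ℕ × ℝ => ∑ k ∈ Finset.range n, (w k).2 := fun n =>
    Finset.measurable_sum _ fun k _ => measurable_snd.comp (measurable_pi_apply k)
  refine MeasurableSet.iUnion fun n => MeasurableSet.inter ?_ (MeasurableSet.inter ?_ ?_)
  · exact (measurable_fst.comp (measurable_pi_apply n)) (measurableSet_singleton _)
  · exact measurableSet_le (hs n) measurable_const
  · exact measurableSet_lt measurable_const (hs (n + 1))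

/-- A visit to `z ≠ i` has index at least `1`, so it comes after the first jump. The second
conclusion rules out `h > t` once holding times are nonnegative. -/
lemma mem_visits_of_cons_mem {i z : ℕ} (hiz : i ≠ z) {t h : ℝ} {w : ℕ → ℕ × ℝ}
    (hw : consTrajectory i (h, w) ∈ visits z t) :
    w ∈ visits z (t - h) ∧ ∃ n, h + ∑ k ∈ Finset.range n, (w k).2 ≤ t := by
  obtain ⟨n, h1, h2, h3⟩ := hw
  cases n with
  | zero => exact absurd h1 hiz
  | succ n =>
    rw [Finset.sum_range_succ'] at h2 h3
    simp only [consTrajectory] at h1 h2 h3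
    exact ⟨⟨n, h1, by linarith, by linarith⟩, n, by linarith⟩

variable {lam : ℕ → ℝ} {Q : ℕ → ℕ → ℝ} {x : ℕ} {Ω : Type*} [MeasurableSpace Ω] {μ : Measure Ω}
  {X : ℝ≥0 → Ω → ℕ}

lemma IsJumpProcess.exists_hasJumpLaw (hX : IsJumpProcess lam Q x μ X) :
    ∃ Y H, HasJumpLaw lam Q x μ Y H ∧ ∀ᵐ ω ∂μ, ∀ (n : ℕ) (t : ℝ≥0),
      ∑ k ∈ Finset.range n, H k ω ≤ t → (t : ℝ) < ∑ k ∈ Finset.range (n + 1), H k ω →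
        X t ω = Y n ω := by
  obtain ⟨Y, H, hY, hH, hlaw, hpath⟩ := hX.exists_jumpChain_holdingTimes
  exact ⟨Y, H, ⟨hY, hH, hlaw⟩, hpath⟩

lemma IsJumpProcess.exp_le_measure (hX : IsJumpProcess lam Q x μ X) (hlam : ∀ i, 0 < lam i)
    (t : ℝ≥0) : ENNReal.ofReal (Real.exp (-(lam x * t))) ≤ μ (X t ⁻¹' {x}) := by
  obtain ⟨Y, H, hlaw, hpath⟩ := hX.exists_hasJumpLaw
  have h := hlaw.measure_eq 0 (fun _ => x) (fun _ => Set.Ioi (t : ℝ)) fun _ => measurableSet_Ioi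
  simp only [if_true, Finset.range_zero, Finset.prod_empty, zero_add, Finset.range_one,
    Finset.prod_singleton, one_mul, expMeasure_Ioi (hlam x) t.coe_nonneg] at h
  rw [← h]
  refine measure_mono_ae ?_
  filter_upwards [hpath] with ω hω hω'
  obtain ⟨h1, h2⟩ := hω' 0 le_rfl
  exact (hω 0 t (by simp) (by simpa using h2)).trans h1

lemma IsJumpProcess.measure_path_ne_zero (hX : IsJumpProcess lam Q x μ X)
    (hlam : ∀ i, 0 < lam i) {t : ℝ≥0} (ht : 0 < t) (n : ℕ) (y : ℕ → ℕ) (hy : y 0 = x)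
    (hQ : ∀ k < n, 0 < Q (y k) (y (k + 1))) : μ (X t ⁻¹' {y n}) ≠ 0 := by
  obtain ⟨Y, H, hlaw, hpath⟩ := hX.exists_hasJumpLaw
  have ht' : (0 : ℝ) < t := ht
  have hn : (0 : ℝ) < n + 1 := by positivity
  -- The first `n` stays are so short that `y n` is reached by time `t`, and the stay there outlasts
  -- `t`.
  set B : ℕ → Set ℝ := fun k => if k < n then Set.Ioo 0 ((t : ℝ) / (n + 1)) else Set.Ioi (t : ℝ)
  have h := hlaw.measure_eq n y B fun k => by
    simp only [B]; split_ifs; exacts [measurableSet_Ioo, measurableSet_Ioi]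
  have hne : μ {ω | ∀ k ≤ n, Y k ω = y k ∧ H k ω ∈ B k} ≠ 0 := by
    rw [h, if_pos hy, one_mul]
    refine mul_ne_zero (Finset.prod_ne_zero_iff.2 fun k hk => ?_)
      (Finset.prod_ne_zero_iff.2 fun k _ => ?_)
    · exact (ENNReal.ofReal_pos.2 (hQ k (Finset.mem_range.1 hk))).ne'
    · simp only [B]
      split_ifs
      · exact expMeasure_Ioo_ne_zero (hlam _) (by positivity)
      · rw [expMeasure_Ioi (hlam _) t.coe_nonneg]
        exact (ENNReal.ofReal_pos.2 (Real.exp_pos _)).ne'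
  refine fun h0 => hne (nonpos_iff_eq_zero.1 (le_trans (measure_mono_ae ?_) h0.le))
  filter_upwards [hpath] with ω hω hω'
  have hlt : ∀ k ∈ Finset.range n, 0 < H k ω ∧ H k ω < t / (n + 1) := fun k hk => by
    simpa [B, Finset.mem_range.1 hk] using (hω' k (Finset.mem_range.1 hk).le).2
  obtain ⟨h1, h2⟩ := hω' n le_rfl
  have h2' : (t : ℝ) < H n ω := by simpa [B] using h2
  refine (hω n t ?_ ?_).trans h1
  · calc ∑ k ∈ Finset.range n, H k ω ≤ ∑ _k ∈ Finset.range n, (t : ℝ) / (n + 1) :=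
          Finset.sum_le_sum fun k hk => (hlt k hk).2.le
      _ = n * (t / (n + 1)) := by simp
      _ ≤ (n + 1) * (t / (n + 1)) := by gcongr; linarith
      _ = t := by field_simp
  · rw [Finset.sum_range_succ]
    linarith [Finset.sum_nonneg fun k hk => (hlt k hk).1.le]

/-- Non-explosion makes `X t` almost surely a function of the trajectory. -/
lemma measure_eq_map_trajectory_visits [IsProbabilityMeasure μ] {Y : ℕ → Ω → ℕ} {H : ℕ → Ω → ℝ}
    (hlaw : HasJumpLaw lam Q x μ Y H) (hlam : ∀ i, 0 < lam i) {M : ℝ} (hM : ∀ i, lam i ≤ M)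
    (hpath : ∀ᵐ ω ∂μ, ∀ (n : ℕ) (t : ℝ≥0), ∑ k ∈ Finset.range n, H k ω ≤ t →
      (t : ℝ) < ∑ k ∈ Finset.range (n + 1), H k ω → X t ω = Y n ω) (z : ℕ) (t : ℝ≥0) :
    μ (X t ⁻¹' {z}) = μ.map (trajectory Y H) (visits z t) := by
  rw [Measure.map_apply hlaw.measurable_trajectory (measurableSet_visits z t)]
  refine measure_congr ?_
  filter_upwards [hpath, hlaw.ae_exists_sum_holding hlam hM] with ω hω hex
  refine propext ⟨fun (hz : X t ω = z) => ?_, ?_⟩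
  · obtain ⟨n, h1, h2⟩ := hex t
    exact ⟨n, (hω n t h1 h2).symm.trans hz, h1, h2⟩
  · rintro ⟨n, hn, h1, h2⟩
    exact (hω n t h1 h2).trans hn

/-- One half of the renewal equation at the first jump, for a process which jumps from `i` to `j`
with probability `1`. -/
lemma IsJumpProcess.measure_le_setLIntegral {i j z : ℕ} {μ' : Measure Ω}
    (hX : IsJumpProcess lam Q i μ X) (hX' : IsJumpProcess lam Q j μ' X)
    (hlam : ∀ i, 0 < lam i) {M : ℝ} (hM : ∀ i, lam i ≤ M)
    (hQ : ∀ k, Q i k = if k = j then 1 else 0) (hiz : i ≠ z) (t : ℝ≥0) (f : ℝ → ℝ≥0∞)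
    (hf : ∀ s : ℝ≥0, μ' (X s ⁻¹' {z}) ≤ f (t - s)) :
    μ (X t ⁻¹' {z}) ≤ ∫⁻ h in Set.Icc 0 (t : ℝ), f h ∂expMeasure (lam i) := by
  have := hX.isProbabilityMeasure
  have := hX'.isProbabilityMeasure
  obtain ⟨Y, H, hlaw, hpath⟩ := hX.exists_hasJumpLaw
  obtain ⟨Y', H', hlaw', hpath'⟩ := hX'.exists_hasJumpLaw
  have := isProbabilityMeasure_expMeasure (hlam i)
  set ν := μ'.map (trajectory Y' H')
  have : IsProbabilityMeasure ν :=
    Measure.isProbabilityMeasure_map hlaw'.measurable_trajectory.aemeasurable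
  have hnonneg : ∀ᵐ w ∂ν, ∀ k, 0 ≤ (w k).2 := by
    rw [ae_map_iff hlaw'.measurable_trajectory.aemeasurable]
    · exact hlaw'.ae_holding_nonneg hlam
    · have : {w : ℕ → ℕ × ℝ | ∀ k, 0 ≤ (w k).2} = ⋂ k, {w | 0 ≤ (w k).2} := by ext; simp
      rw [this]
      exact MeasurableSet.iInter fun k =>
        measurableSet_le measurable_const (measurable_snd.comp (measurable_pi_apply k))
  have hm := measurable_consTrajectory i (measurableSet_visits z t)
  rw [measure_eq_map_trajectory_visits hlaw hlam hM hpath,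
    hlaw.map_trajectory_eq_map_cons hlaw' (hlam i) hQ,
    Measure.map_apply (measurable_consTrajectory i) (measurableSet_visits z t),
    Measure.prod_apply hm, ← lintegral_indicator measurableSet_Icc]
  refine lintegral_mono_ae ?_
  have hpos : ∀ᵐ h ∂expMeasure (lam i), 0 ≤ h := by
    refine measure_mono_null (fun h hh => ?_) (expMeasure_Iio_zero (hlam i))
    simpa using hh
  filter_upwards [hpos] with h hh
  by_cases hht : h ≤ t
  · rw [Set.indicator_of_mem (show h ∈ Set.Icc 0 (t : ℝ) from ⟨hh, hht⟩)]
    obtain ⟨s, hs⟩ : ∃ s : ℝ≥0, (s : ℝ) = t - h := ⟨⟨_, sub_nonneg.2 hht⟩, rfl⟩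
    have h1 := hf s
    rw [measure_eq_map_trajectory_visits hlaw' hlam hM hpath', hs, sub_sub_cancel] at h1
    exact le_trans (measure_mono fun w hw => (mem_visits_of_cons_mem hiz hw).1) h1
  · refine le_of_eq_of_le ?_ zero_le
    refine measure_mono_null (t := {w | ∀ k, 0 ≤ (w k).2}ᶜ) (fun w hw hw0 => ?_) hnonneg
    obtain ⟨n, hn⟩ := (mem_visits_of_cons_mem hiz hw).2
    linarith [Finset.sum_nonneg fun k (_ : k ∈ Finset.range n) => hw0 k, not_le.1 hht]

end Renewal

/-! ### Total variation bounds from a single event. -/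

section TotalVariation

variable {α : Type*} [MeasurableSpace α] (μ ν : Measure α) [IsProbabilityMeasure μ]
  [IsProbabilityMeasure ν] {A : Set α}

lemma sub_le_tvNorm (hA : MeasurableSet A) : μ.real A - ν.real A ≤ tvNorm μ ν := by
  have hbdd : BddAbove (Set.range fun A : {A : Set α // MeasurableSet A} =>
      μ.real A - ν.real A) := ⟨1, by
    rintro _ ⟨A, rfl⟩
    linarith [measureReal_nonneg (μ := ν) (s := A), measureReal_le_one (μ := μ) (s := A)]⟩
  have hbdd' : BddBelow (Set.range fun A : {A : Set α // MeasurableSet A} =>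
      μ.real A - ν.real A) := ⟨-1, by
    rintro _ ⟨A, rfl⟩
    linarith [measureReal_nonneg (μ := μ) (s := A), measureReal_le_one (μ := ν) (s := A)]⟩
  have h1 := le_ciSup hbdd ⟨A, hA⟩
  -- The empty set shows that the infimum is at most `0`.
  have h2 := ciInf_le hbdd' ⟨∅, MeasurableSet.empty⟩
  simp only [measureReal_empty, sub_zero] at h1 h2
  unfold tvNorm
  linarith

lemma sub_le_tvNorm' (hA : MeasurableSet A) : ν.real A - μ.real A ≤ tvNorm μ ν := by
  have := sub_le_tvNorm μ ν hA.compl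
  rw [probReal_compl_eq_one_sub hA, probReal_compl_eq_one_sub hA] at this
  linarith

end TotalVariation

/-! ### Irreducibility, zero conductance and failure of geometric ergodicity. -/

section Toy

variable {lam p : ℕ → ℝ} {Ω : Type*} [MeasurableSpace Ω] {P : ℕ → Measure Ω} {X : ℝ≥0 → Ω → ℕ}

lemma transition_apply (hX : ∀ x, IsJumpProcess lam (jumpMatrix p) x (P x) X) (t : ℝ≥0) (x : ℕ)
    (A : Set ℕ) : transition P X t x A = P x (X t ⁻¹' A) :=
  Measure.map_apply ((hX x).measurable t) (MeasurableSet.of_discrete)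

lemma isProbabilityMeasure_transition (hX : ∀ x, IsJumpProcess lam (jumpMatrix p) x (P x) X)
    (t : ℝ≥0) (x : ℕ) : IsProbabilityMeasure (transition P X t x) :=
  have := (hX x).isProbabilityMeasure
  Measure.isProbabilityMeasure_map ((hX x).measurable t).aemeasurable

lemma transition_ne_zero (hlam : ∀ i, 0 < lam i) (hp : ∀ i, 1 ≤ i → 0 < p i)
    (hX : ∀ x, IsJumpProcess lam (jumpMatrix p) x (P x) X) {t : ℝ≥0} (ht : 0 < t) (x j : ℕ) :
    transition P X t x {j} ≠ 0 := by
  rw [transition_apply hX]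
  have hto : ∀ i, 1 ≤ i → 0 < jumpMatrix p 0 i := fun i hi => by simp [jumpMatrix, hp i hi]
  have hback : ∀ i, 1 ≤ i → 0 < jumpMatrix p i 0 := fun i hi => by
    simp [jumpMatrix, Nat.one_le_iff_ne_zero.1 hi]
  rcases Nat.eq_zero_or_pos x with rfl | hx <;> rcases Nat.eq_zero_or_pos j with rfl | hj
  · exact (hX 0).measure_path_ne_zero hlam ht 0 (fun _ => 0) rfl (by simp)
  -- Up to index `1`, `k * j` is the path `0, j`.
  · refine (hX 0).measure_path_ne_zero hlam ht 1 (fun k => k * j) (by simp) ?_ |> fun h => by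
      simpa using h
    intro k hk
    obtain rfl : k = 0 := by omega
    simpa using hto j hj
  · refine (hX x).measure_path_ne_zero hlam ht 1 (fun k => if k = 0 then x else 0) (by simp) ?_
    intro k hk
    obtain rfl : k = 0 := by omega
    simpa using hback x hx
  · refine (hX x).measure_path_ne_zero hlam ht 2
      (fun k => if k = 0 then x else if k = 1 then 0 else j) (by simp) ?_
    intro k hk
    obtain rfl | rfl : k = 0 ∨ k = 1 := by omega
    · simpa using hback x hx
    · simpa using hto j hj

lemma IsInvariantDistribution.singleton_ne_zero (hlam : ∀ i, 0 < lam i)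
    (hp : ∀ i, 1 ≤ i → 0 < p i) (hX : ∀ x, IsJumpProcess lam (jumpMatrix p) x (P x) X)
    {π : Measure ℕ} (hπ : IsInvariantDistribution (transition P X) π) (j : ℕ) : π {j} ≠ 0 := by
  have := hπ.1
  intro h
  have hinv : π.bind (transition P X 1) = π := hπ.2 1
  rw [← hinv, Measure.bind_apply (measurableSet_singleton j) (Kernel.aemeasurable _),
    lintegral_eq_zero_iff (Kernel.measurable_coe _ (measurableSet_singleton j))] at h
  obtain ⟨x, hx⟩ := h.exists
  exact transition_ne_zero hlam hp hX one_pos x j hx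

lemma frequently_lam_lt (hbdd : BddAbove (Set.range lam))
    (hlim : liminf lam atTop = 0) {ε : ℝ} (hε : 0 < ε) : ∃ᶠ i in atTop, lam i < ε :=
  frequently_lt_of_liminf_lt (hbdd.isBoundedUnder_of_range.isCoboundedUnder_ge) (hlim.trans_lt hε)

theorem conductance_eq_zero (hlam : ∀ i, 0 < lam i) (hbdd : BddAbove (Set.range lam))
    (hp : ∀ i, 1 ≤ i → 0 < p i) (hlim : liminf lam atTop = 0)
    (hX : ∀ x, IsJumpProcess lam (jumpMatrix p) x (P x) X)
    {π : Measure ℕ} (hπ : IsInvariantDistribution (transition P X) π) {m : ℝ≥0} (hm : 0 < m) :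
    conductance π (transition P X m) = 0 := by
  have := hπ.1
  have hm' : (0 : ℝ) < m := hm
  have htend : Tendsto (fun i => π {i}) atTop (𝓝 0) := by
    refine ENNReal.tendsto_atTop_zero_of_tsum_ne_top ?_
    have := measure_iUnion (μ := π) (f := fun i : ℕ => ({i} : Set ℕ))
      (fun i j hij => Set.disjoint_singleton.2 hij) fun i => measurableSet_singleton i
    rw [← this]
    exact measure_ne_top _ _
  have hhalf : ∀ᶠ i in atTop, π {i} < 2⁻¹ :=
    htend.eventually_lt_const (by simp)
  refine nonpos_iff_eq_zero.1 (ENNReal.le_of_forall_pos_le_add fun ε hε _ => ?_)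
  have hε' : (0 : ℝ) < ε := hε
  -- The threshold turns the bound `2 * lam i * m` into `ε`.
  obtain ⟨i, hi, hi'⟩ := ((frequently_lam_lt hbdd hlim (ε := ε / (2 * m))
    (by positivity)).and_eventually hhalf).exists
  have h0 := hπ.singleton_ne_zero hlam hp hX i
  have hc : (2⁻¹ : ℝ≥0∞) ≤ π {i}ᶜ := by
    rw [prob_compl_eq_one_sub (measurableSet_singleton i), ← ENNReal.one_sub_inv_two]
    exact tsub_le_tsub_left hi'.le 1
  have hc0 : π {i}ᶜ ≠ 0 := fun h => by simp [h] at hc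
  have hK : transition P X m i {i}ᶜ ≤ ENNReal.ofReal (lam i * m) := by
    have := isProbabilityMeasure_transition hX m i
    rw [prob_compl_eq_one_sub (measurableSet_singleton i), transition_apply hX]
    refine (tsub_le_tsub_left ((hX i).exp_le_measure hlam m) 1).trans ?_
    rw [← ENNReal.ofReal_one, ← ENNReal.ofReal_sub _ (Real.exp_pos _).le]
    exact ENNReal.ofReal_le_ofReal (by linarith [Real.add_one_le_exp (-(lam i * m))])
  refine (iInf₂_le_of_le {i} (measurableSet_singleton i) (iInf₂_le_of_le h0 hc0 ?_))
  rw [lintegral_singleton, ENNReal.mul_inv (Or.inl h0) (Or.inl (measure_ne_top _ _)), zero_add]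
  calc (π {i})⁻¹ * (π {i}ᶜ)⁻¹ * (transition P X m i {i}ᶜ * π {i})
      = ((π {i})⁻¹ * π {i}) * ((π {i}ᶜ)⁻¹ * transition P X m i {i}ᶜ) := by ring
    _ = (π {i}ᶜ)⁻¹ * transition P X m i {i}ᶜ := by
        rw [ENNReal.inv_mul_cancel h0 (measure_ne_top _ _), one_mul]
    _ ≤ 2 * ENNReal.ofReal (lam i * m) := by
        gcongr
        simpa using ENNReal.inv_le_inv.2 hc
    _ = ENNReal.ofReal (2 * (lam i * m)) := by
        rw [ENNReal.ofReal_mul zero_le_two, ENNReal.ofReal_ofNat]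
    _ ≤ ε := by
        rw [← ENNReal.ofReal_coe_nnreal]
        refine ENNReal.ofReal_le_ofReal ?_
        rw [lt_div_iff₀ (by positivity)] at hi
        linarith

theorem not_isGeometricallyErgodic (hlam : ∀ i, 0 < lam i) (hbdd : BddAbove (Set.range lam))
    (hp : ∀ i, 1 ≤ i → 0 < p i) (hlim : liminf lam atTop = 0)
    (hX : ∀ x, IsJumpProcess lam (jumpMatrix p) x (P x) X) :
    ¬ IsGeometricallyErgodic (transition P X) := by
  rintro ⟨π, hπ, κ, hκ, hconv⟩
  have := hπ.1
  have hprob := isProbabilityMeasure_transition hX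
  obtain ⟨M, hM⟩ := hbdd
  have hM' : ∀ i, lam i ≤ M := fun i => hM ⟨i, rfl⟩
  have hκ0 : 0 < κ := one_pos.trans hκ
  set b := Real.log κ
  have hb : 0 < b := Real.log_pos hκ
  have hκexp : ∀ t : ℝ, κ ^ t = Real.exp (b * t) := fun t => Real.rpow_def_of_pos hκ0 t
  set a := π.real {0}
  have ha : 0 < a := ENNReal.toReal_pos (hπ.singleton_ne_zero hlam hp hX 0) (measure_ne_top _ _)
  obtain ⟨c, hc, hbound⟩ : ∃ c > 0, ∀ s : ℝ≥0,
      (transition P X s 0).real {0} ≤ a + c * Real.exp (-(b * s)) := by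
    obtain ⟨T, hT⟩ := eventually_atTop.1 ((hconv 0).eventually_lt_const one_pos)
    -- This `c` makes `c * exp (-(b * s))` at least `1` for `s ≤ T`, where the trivial bound
    -- suffices; beyond `T` convergence from `0` applies.
    refine ⟨Real.exp (b * T), Real.exp_pos _, fun s => ?_⟩
    rw [← Real.exp_add]
    rcases le_total T s with h | h
    · have h1 := hT s h
      have h2 := sub_le_tvNorm (transition P X s 0) π (measurableSet_singleton 0)
      rw [hκexp, mul_comm, ← lt_div_iff₀ (Real.exp_pos _), one_div, ← Real.exp_neg] at h1
      have h3 : Real.exp (-(b * s)) ≤ Real.exp (b * T + -(b * s)) :=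
        Real.exp_le_exp.2 (by have : 0 ≤ b * (T : ℝ) := by positivity
                              linarith)
      linarith
    · have h1 : (transition P X s 0).real {0} ≤ 1 := measureReal_le_one
      have h2 : (s : ℝ) ≤ T := h
      have h3 : 1 ≤ Real.exp (b * T + -(b * s)) := Real.one_le_exp (by nlinarith)
      linarith
  -- The first bound gives `b - lam i > b / 2`; with the second, `c * lam i < a * b / 4`, hence
  -- `hcl`.
  obtain ⟨i, hi, hi1⟩ := ((frequently_lam_lt ⟨M, hM⟩ hlim (ε := min (b / 2) (a * b / (4 * c)))
    (by positivity)).and_eventually (eventually_ge_atTop 1)).exists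
  obtain ⟨hi2, hi3⟩ := lt_min_iff.1 hi
  have hli := hlam i
  have hcl : c * (lam i / (b - lam i)) ≤ a / 2 := by
    rw [lt_div_iff₀ (by positivity)] at hi3
    rw [← mul_div_assoc, div_le_iff₀ (by linarith)]
    nlinarith
  have hupper : ∀ t : ℝ≥0, (transition P X t i).real {0} ≤
      a - a / 2 * Real.exp (-(lam i * t)) := by
    intro t
    have hexp : Real.exp (-(lam i * t)) ≤ 1 := Real.exp_le_one_iff.2 (by
      have : 0 ≤ lam i * (t : ℝ) := by positivity
      linarith)
    have h1 := (hX i).measure_le_setLIntegral (j := 0) (z := 0) (hX 0) hlam hM'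
      (fun k => by simp [jumpMatrix, Nat.one_le_iff_ne_zero.1 hi1])
      (Nat.one_le_iff_ne_zero.1 hi1) t
      (fun h => ENNReal.ofReal (a + c * Real.exp (-(b * (t - h))))) (fun s => by
        rw [← transition_apply hX, sub_sub_cancel, ← ofReal_measureReal]
        exact ENNReal.ofReal_le_ofReal (hbound s))
    have h2 := h1.trans (setLIntegral_expMeasure_le hli t.coe_nonneg ha.le hc.le
      (by linarith : lam i < b))
    rw [← transition_apply hX, ← ofReal_measureReal] at h2
    have h3 := Real.exp_pos (-(lam i * t))
    have hd : 0 ≤ lam i / (b - lam i) := div_nonneg hli.le (by linarith)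
    have h4 := (ENNReal.ofReal_le_ofReal_iff (add_nonneg (mul_nonneg ha.le (sub_nonneg.2 hexp))
      (mul_nonneg (mul_nonneg hc.le hd) h3.le))).1 h2
    have h5 := mul_le_mul_of_nonneg_right hcl h3.le
    linarith
  -- At such a `t` the scaled distance is below `a / 2`, yet it is at least `a / 2 * exp ((b - lam
  -- i) * t) ≥ a / 2`.
  obtain ⟨t, ht⟩ := ((hconv i).eventually_lt_const (half_pos ha)).exists
  have h1 := sub_le_tvNorm' (transition P X t i) π (measurableSet_singleton 0)
  have h2 := hupper t
  have h3 : a / 2 * Real.exp (-(lam i * t)) ≤ tvNorm (transition P X t i) π := by linarith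
  have h4 : 1 ≤ Real.exp (b * t) * Real.exp (-(lam i * t)) := by
    rw [← Real.exp_add]
    refine Real.one_le_exp ?_
    have : 0 ≤ (b - lam i) * (t : ℝ) := mul_nonneg (by linarith) t.coe_nonneg
    linarith
  rw [hκexp] at ht
  have h5 := mul_le_mul_of_nonneg_left h3 (Real.exp_pos (b * t)).le
  nlinarith

end Toy

end ToyJump

theorem lemma10 (lam p : ℕ → ℝ)
    (hlam_pos : ∀ i, 0 < lam i) (hlam_bdd : BddAbove (Set.range lam))
    (hp_zero : p 0 = 0) (hp_pos : ∀ i, 1 ≤ i → 0 < p i) (hp_sum : HasSum p 1)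
    (hlam_liminf : liminf lam atTop = 0) (hsum : Summable fun i => p i * (lam i)⁻¹)
    {Ω : Type*} [MeasurableSpace Ω] (P : ℕ → Measure Ω) (X : ℝ≥0 → Ω → ℕ)
    (hX : ∀ x, ToyJump.IsJumpProcess lam (ToyJump.jumpMatrix p) x (P x) X) :
    ¬ ToyJump.IsGeometricallyErgodic (ToyJump.transition P X) ∧
      ∀ π : Measure ℕ, ToyJump.IsInvariantDistribution (ToyJump.transition P X) π →
        ∀ m : ℝ≥0, 0 < m → ToyJump.conductance π (ToyJump.transition P X m) = 0 := by
  exact ⟨ToyJump.not_isGeometricallyErgodic hlam_pos hlam_bdd hp_pos hlam_liminf hX,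
    fun π hπ m hm => ToyJump.conductance_eq_zero hlam_pos hlam_bdd hp_pos hlam_liminf hX hπ hm⟩
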